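/- **Conventions.** Let $G$ be a group. A finite symmetric presentation $\mathcal P=\langle A\mid R\rangle$ of $G$ consists of a finite alphabet $A$ closed under formal inversion, each letter representing a non-identity element of $G$, and a finite set $R$ of nonempty words over $A$, closed under formal inversion and cyclic conjugation and containing every nonempty freely reduced form of its elements, such that $G$ is generated by $A$ subject to the defining relations $aa^{-1}=1$ ($a\in A$) and $r=1$ ($r\in R$). "Finite presentation" below means finite symmetric presentation. The Cayley complex $X=X(G,\mathcal P)$ is the 2-complex with vertex set $G$, an edge from $g$ to $ga$ labelled $a$ for $g\in G$, $a\in A$ (the edge labelled $a^{-1}$ from $ga$ to $g$ being the same edge reversed), and one 2-cell for each closed edge path labelled by an element of $R$, up to choice of starting point and direction. Let $\epsilon$ be the vertex of the identity. For a connected 2-complex $Y$ with base vertex $y$, the *coarse distance* $\tilde d_Y(y,p)$ is the path distance in $Y^{(1)}$ if $p$ is a vertex; it is $\min\{\tilde d_Y(y,v): v\in\partial e\}+\frac12$ if $p$ is interior to an edge $e$; and it is $\max\{\tilde d_Y(y,q): q\in\partial\sigma\setminus Y^{(0)}\}-\frac14$ if $p$ is interior to a 2-cell $\sigma$. Its values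 lie in $\mathbb N[\frac14]:=\{n/4: n\in\mathbb N\}$. For a subcomplex $Z\subseteq Y^{(1)}$ and a vertex $y_0$, a *1-combing* of $(Y,Z)$ at $y_0$ is a continuous map $\Psi:Z\times[0,1]\to Y$ with $\Psi(p,0)=y_0$ and $\Psi(p,1)=p$ for all $p\in Z$; $\Psi(y_0,t)=y_0$ for all $t$ if $y_0\in Z$; and $\Psi(p,t)\in Y^{(1)}$ for all $t$ whenever $p$ is a vertex of $Z$. A *van Kampen diagram* for a word $w$ over $\mathcal P$ is a finite planar contractible 2-complex $\Delta$ with base vertex $*$ and directed edges labelled by $A$ (a reversed edge having the inverse label), whose 2-cells have boundary labels in $R$ and whose boundary circuit $\partial\Delta$, read from $*$, has label $w$. Let $\pi_\Delta:\Delta\to X$ be the cellular map with $\pi_\Delta(*)=\epsilon$ that takes $n$-cells to $n$-cells and preserves edge and 2-cell boundary labels and directions. A nondecreasing function $f:\mathbb N[\frac14]\to\mathbb N[\frac14]$ is an *extrinsic tame filling function* for $G$ over $\mathcal P$ if for every word $w$ over $A$ that represents the identity of $G$ there are a van Kampen diagram $\Delta$ for $w$ and a 1-combing $\Psi$ of $(\Delta,\partial\Delta)$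 at $*$ such that $$\tilde d_X(\epsilon,\pi_\Delta\Psi(p,s))\le f\bigl(\tilde d_X(\epsilon,\pi_\Delta\Psi(p,t))\bigr)\quad\text{for all }p\in\partial\Delta,\ 0\le s<t\le1 .$$ The group $G$ is *tame combable* if for some finite presentation of $G$, with Cayley complex $X$, there is a 1-combing $\Psi$ of $(X,X^{(1)})$ at $\epsilon$ such that for each compact $C\subseteq X$ there is a compact $D\subseteq X$ such that for every closed 0- or 1-cell $\tau$ of $X$ the set $\Psi^{-1}(C)\cap(\tau\times[0,1])$ is contained in a single path component of $\Psi^{-1}(D)\cap(\tau\times[0,1])$. **Statement.** If a group $G$ has an extrinsic tame filling function over some finite presentation, then $G$ is tame combable. -/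

import Mathlib

universe u

open Set

/-- A combinatorial 2-complex: vertices `V`, directed edges `E` with the fixed-point-free involution
`rev` reversing the direction (an undirected edge is a pair `{e, rev e}`), and 2-cells `F`, where
the 2-cell `f` is a polygon whose sides are read off around the closed edge path
`bdry f 0, bdry f 1, …`. -/
structure TwoComplex where
  V : Type u
  E : Type u
  F : Type u
  src : E → V
  rev : E → E
  rev_rev : ∀ e, rev (rev e) = e
  rev_ne : ∀ e, rev e ≠ e
  sides : F → ℕ
  sides_pos : ∀ f, 0 < sides f
  bdry : (f : F) → Fin (sides f) → E
  /-- consecutive sides (cyclically) share the intermediate vertex -/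
  bdry_closed : ∀ f i, src (rev (bdry f i)) = src (bdry f (finRotate _ i))

namespace TwoComplex

variable (K : TwoComplex.{u})

/-- The terminal vertex of a directed edge. -/
def tgt (e : K.E) : K.V := K.src (K.rev e)

/-- `K.IsPath u l v`: the list `l` of directed edges is an edge path from `u` to `v`. -/
def IsPath : K.V → List K.E → K.V → Prop
  | u, [], v => u = v
  | u, e :: l, v => K.src e = u ∧ IsPath (K.tgt e) l v

/-- The path metric on the vertices of the 1-skeleton (of a connected complex). -/
noncomputable def vdist (u v : K.V) : ℕ := sInf {n | ∃ l : List K.E, l.length = n ∧ K.IsPath u l v}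

/-! ### The geometric realization

A directed edge contributes a copy of `[0,1]`, and a 2-cell with `n` sides contributes an `n`-gon,
described as the cone over its boundary: `face f i s r` lies in the triangle spanned by the centre
and the `i`-th side, on the segment from the centre (`r = 0`) to the point with parameter `s` on
the `i`-th side (`r = 1`). -/

/-- Points of the disjoint union of the vertices, edges and polygons (before gluing). -/
inductive PrePoint : Type u
  | vtx (v : K.V)
  | edge (e : K.E) (t : unitInterval)
  | face (f : K.F) (i : Fin (K.sides f)) (s r : unitInterval)

/-- The identifications that glue the cells together. -/
inductive Glue : K.PrePoint → K.PrePoint → Prop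
  | edge_zero (e : K.E) : Glue (.edge e 0) (.vtx (K.src e))
  | edge_rev (e : K.E) (t : unitInterval) : Glue (.edge e t) (.edge (K.rev e) (unitInterval.symm t))
  | face_centre (f : K.F) (i j : Fin (K.sides f)) (s t : unitInterval) :
      Glue (.face f i s 0) (.face f j t 0)
  | face_side (f : K.F) (i : Fin (K.sides f)) (r : unitInterval) :
      Glue (.face f i 1 r) (.face f (finRotate _ i) 0 r)
  | face_bdry (f : K.F) (i : Fin (K.sides f)) (s : unitInterval) :
      Glue (.face f i s 1) (.edge (K.bdry f i) s)

/-- The geometric realization of `K`. -/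
def Realization : Type u := Quot K.Glue

/-- The point of the realization given by a vertex. -/
def vtx (v : K.V) : K.Realization := Quot.mk _ (.vtx v)

/-- The characteristic map of a directed edge. -/
def edge (e : K.E) (t : unitInterval) : K.Realization := Quot.mk _ (.edge e t)

/-- The characteristic map of a 2-cell, in polygon coordinates. -/
def face (f : K.F) (i : Fin (K.sides f)) (s r : unitInterval) : K.Realization :=
  Quot.mk _ (.face f i s r)

/-- The weak (CW) topology: a set is open iff its preimages under all characteristic maps are. -/
instance : TopologicalSpace K.Realization :=
  (⨆ e : K.E, TopologicalSpace.coinduced (K.edge e) inferInstance) ⊔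
  (⨆ f : K.F, ⨆ i : Fin (K.sides f),
    TopologicalSpace.coinduced (fun q : unitInterval × unitInterval => K.face f i q.1 q.2)
      inferInstance)

/-- The 0-skeleton. -/
def skel0 : Set K.Realization := range K.vtx

/-- The 1-skeleton. -/
def skel1 : Set K.Realization := range K.vtx ∪ ⋃ e, range (K.edge e)

/-- The open 2-cell `f`. -/
def openFace (f : K.F) : Set K.Realization :=
  {x | ∃ i s r, r ≠ 1 ∧ x = K.face f i s r}

/-! ### Coarse distance -/

/-- The coarse distance from `y` to the points in the interior of an edge. -/
noncomputable def edgeLevel (y : K.V) (e : K.E) : ℚ :=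
  min (K.vdist y (K.src e) : ℚ) (K.vdist y (K.tgt e)) + 1 / 2

/-- The coarse distance from `y` to the points in the interior of a 2-cell. -/
noncomputable def faceLevel (y : K.V) (f : K.F) : ℚ :=
  Finset.univ.sup' ⟨⟨0, K.sides_pos f⟩, Finset.mem_univ _⟩ (fun i => K.edgeLevel y (K.bdry f i))
    - 1 / 4

/-- The coarse distance on a closed edge. -/
noncomputable def edgePtLevel (y : K.V) (e : K.E) (t : unitInterval) : ℚ :=
  open Classical in
  if t = 0 then K.vdist y (K.src e)
  else if t = 1 then K.vdist y (K.tgt e)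
  else K.edgeLevel y e

/-- The coarse distance on the cells before gluing. -/
noncomputable def preLevel (y : K.V) : K.PrePoint → ℚ
  | .vtx v => K.vdist y v
  | .edge e t => K.edgePtLevel y e t
  | .face f i s r =>
      open Classical in
      if r = 1 then K.edgePtLevel y (K.bdry f i) s else K.faceLevel y f

theorem preLevel_glue (y : K.V) (a b : K.PrePoint) (h : K.Glue a b) :
    K.preLevel y a = K.preLevel y b := by
  have h01 : (0 : unitInterval) ≠ 1 := zero_ne_one
  cases h with
  | edge_zero e => simp [preLevel, edgePtLevel]
  | edge_rev e t =>
      by_cases h0 : t = 0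
      · subst h0; simp [preLevel, edgePtLevel, tgt, K.rev_rev]
      · by_cases h1 : t = 1
        · subst h1; simp [preLevel, edgePtLevel, tgt]
        · have h0' : unitInterval.symm t ≠ 0 := by simpa using h1
          have h1' : unitInterval.symm t ≠ 1 := by simpa using h0
          simp only [preLevel, edgePtLevel, h0, h1, h0', h1', if_false, edgeLevel, tgt, K.rev_rev]
          rw [min_comm]
  | face_centre f i j s t => simp [preLevel]
  | face_side f i r =>
      by_cases hr : r = 1
      · simp [preLevel, hr, edgePtLevel, tgt, K.bdry_closed]
      · simp [preLevel, hr]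
  | face_bdry f i s => simp [preLevel]

/-- The coarse distance from the vertex `y` to a point of the realization: the path metric at
vertices, the distance to the nearer end plus `1/2` in the interior of an edge, and the maximum over
the interiors of the boundary edges minus `1/4` in the interior of a 2-cell. -/
noncomputable def coarseDist (y : K.V) : K.Realization → ℚ :=
  Quot.lift (K.preLevel y) (K.preLevel_glue y)

/-! ### 1-combings -/

/-- `ψ` is a 1-combing of the pair `(K, Z)` at the basepoint `y`, for a subcomplex `Z` of the
1-skeleton. -/
structure IsOneCombing (Z : Set K.Realization) (y : K.V)
    (ψ : Z × unitInterval → K.Realization) : Prop where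
  continuous : Continuous ψ
  zero : ∀ p, ψ (p, 0) = K.vtx y
  one : ∀ p, ψ (p, 1) = p.1
  base : ∀ h : K.vtx y ∈ Z, ∀ t, ψ (⟨K.vtx y, h⟩, t) = K.vtx y
  vertex : ∀ p : Z, p.1 ∈ K.skel0 → ∀ t, ψ (p, t) ∈ K.skel1

/-- The function `φ : Z × [0,1] → K` is `f`-tame with respect to the basepoint `y`. -/
def IsTame (y : K.V) (f : ℚ → ℚ) {Z : Type*} (φ : Z × unitInterval → K.Realization) : Prop :=
  ∀ (p : Z) (s t : unitInterval), s < t →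
    K.coarseDist y (φ (p, s)) ≤ f (K.coarseDist y (φ (p, t)))

end TwoComplex

/-- The set of nonnegative integer multiples of `1/4`, in which coarse distances take values. -/
def quarterNat : Set ℚ := {q | ∃ n : ℕ, q = n / 4}

/-- A finite symmetric presentation `⟨A | R⟩` of the group `G`. The alphabet `A` is closed under
formal inversion `inv`; a letter is allowed to be its own formal inverse (it then stands for an
element of order two), as happens when `A` is an inverse-closed subset of `G`. -/
structure SymPresentation (G : Type*) [Group G] where
  A : Type
  finite_A : Finite A
  inv : A → A
  inv_inv : ∀ a, inv (inv a) = a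
  /-- the element of `G` represented by a letter -/
  rep : A → G
  rep_ne_one : ∀ a, rep a ≠ 1
  R : Set (List A)
  finite_R : R.Finite
  nil_notMem : [] ∉ R
  inv_mem : ∀ r ∈ R, (r.map inv).reverse ∈ R
  rotate_mem : ∀ u v, u ++ v ∈ R → v ++ u ∈ R
  /-- the nonempty freely reduced forms of the relators are relators -/
  reduced_mem : ∀ r ∈ R, ∀ s,
    Relation.ReflTransGen (fun w w' => ∃ u a v, w = u ++ a :: inv a :: v ∧ w' = u ++ v) r s →
    (∀ u a v, s ≠ u ++ a :: inv a :: v) → s ≠ [] → s ∈ R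
  /-- the letters generate `G` -/
  surj : Function.Surjective (FreeGroup.lift rep)
  /-- the relations `a · inv a = 1` (`a ∈ A`) and `r = 1` (`r ∈ R`) define `G` -/
  ker_eq : (FreeGroup.lift rep).ker = Subgroup.normalClosure
    (range (fun a => FreeGroup.of a * FreeGroup.of (inv a)) ∪
      (fun r : List A => (r.map FreeGroup.of).prod) '' R)

namespace SymPresentation

variable {G : Type u} [Group G] (P : SymPresentation G)

/-- The element of `G` represented by a word. -/
def eval (w : List P.A) : G := (w.map P.rep).prod

theorem rep_mul_inv (a : P.A) : P.rep a * P.rep (P.inv a) = 1 := by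
  have h : FreeGroup.of a * FreeGroup.of (P.inv a) ∈ (FreeGroup.lift P.rep).ker := by
    rw [P.ker_eq]
    exact Subgroup.subset_normalClosure (Or.inl ⟨a, rfl⟩)
  simpa [MonoidHom.mem_ker] using h

theorem eval_relator (r : List P.A) (hr : r ∈ P.R) : P.eval r = 1 := by
  have h : (r.map FreeGroup.of).prod ∈ (FreeGroup.lift P.rep).ker := by
    rw [P.ker_eq]
    exact Subgroup.subset_normalClosure (Or.inr ⟨r, hr, rfl⟩)
  rw [MonoidHom.mem_ker, map_list_prod, List.map_map] at h
  have hc : (⇑(FreeGroup.lift P.rep) ∘ FreeGroup.of) = P.rep := by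
    funext a; simp
  rw [hc] at h
  exact h

/-! ### The Cayley complex

There is one directed edge `(g, a)` from `g` to `g * a` for all `g ∈ G`, `a ∈ A`, with reverse
`(g * a, a⁻¹)`, and one 2-cell for each closed edge path labelled by a relator, where closed paths
that differ by the choice of the starting point and of the direction bound the same 2-cell. -/

/-- Based closed edge paths in the Cayley graph labelled by relators: `(g, r)` is the path that
starts at `g` and is labelled `r`. -/
def RelatorLoop : Type u := {x : G × List P.A // x.2 ∈ P.R}

/-- Moving the starting point one step along the loop, and reversing the direction. -/
inductive LoopRel : P.RelatorLoop → P.RelatorLoop → Prop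
  | rotate (g : G) (a : P.A) (u : List P.A) (h : a :: u ∈ P.R) (h' : u ++ [a] ∈ P.R) :
      LoopRel ⟨(g, a :: u), h⟩ ⟨(g * P.rep a, u ++ [a]), h'⟩
  | reverse (g : G) (r : List P.A) (h : r ∈ P.R) (h' : (r.map P.inv).reverse ∈ P.R) :
      LoopRel ⟨(g, r), h⟩ ⟨(g, (r.map P.inv).reverse), h'⟩

/-- The 2-cells of the Cayley complex. -/
def Cell : Type u := Quot P.LoopRel

/-- The 2-cell bounded by the closed path that starts at `g` and is labelled by the relator `r`. -/
def cell (g : G) (r : List P.A) (h : r ∈ P.R) : P.Cell := Quot.mk _ ⟨(g, r), h⟩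

/-- The starting vertex of the chosen boundary path of a 2-cell. -/
noncomputable def cellStart (c : P.Cell) : G := (Quot.out c).1.1

/-- The label of the chosen boundary path of a 2-cell. -/
noncomputable def cellWord (c : P.Cell) : List P.A := (Quot.out c).1.2

theorem cellWord_mem (c : P.Cell) : P.cellWord c ∈ P.R := (Quot.out c).2

theorem eval_take_succ (w : List P.A) (i : Fin w.length) :
    P.eval (w.take i) * P.rep (w.get i) = P.eval (w.take (i + 1)) := by
  obtain ⟨i, hi⟩ := i
  simp only [eval, List.get_eq_getElem, List.take_succ_eq_append_getElem hi, List.map_append,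
    List.prod_append, List.map_cons, List.map_nil, List.prod_cons, List.prod_nil, mul_one]

theorem loop_closed (g : G) (w : List P.A) (hw : P.eval w = 1) (i : Fin w.length) :
    g * P.eval (w.take i) * P.rep (w.get i) = g * P.eval (w.take (finRotate _ i : Fin w.length)) := by
  rw [mul_assoc, eval_take_succ]
  congr 1
  obtain ⟨i, hi⟩ := i
  obtain ⟨n, hn⟩ : ∃ n, w.length = n + 1 := ⟨w.length - 1, by omega⟩
  by_cases h : i = n
  · have h1 : ((finRotate w.length ⟨i, hi⟩ : Fin w.length) : ℕ) = 0 := by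
      subst h
      revert hi
      rw [hn]
      intro hi
      rw [show (⟨i, hi⟩ : Fin (i + 1)) = Fin.last i from rfl, finRotate_last]
      rfl
    rw [h1]
    have h2 : w.take (i + 1) = w := List.take_of_length_le (by omega)
    simp only [h2, hw]
    simp [eval]
  · have h1 : ((finRotate w.length ⟨i, hi⟩ : Fin w.length) : ℕ) = i + 1 := by
      revert hi
      rw [hn]
      intro hi
      rw [finRotate_of_lt (by omega)]
    rw [h1]

/-- The Cayley 2-complex of the presentation. -/
noncomputable def cayley : TwoComplex.{u} where
  V := G
  E := G × P.A
  F := P.Cell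
  src e := e.1
  rev e := (e.1 * P.rep e.2, P.inv e.2)
  rev_rev e := by
    ext <;> simp [mul_assoc, P.rep_mul_inv, P.inv_inv]
  rev_ne e h := by
    have := congrArg Prod.fst h
    simp [P.rep_ne_one] at this
  sides c := (P.cellWord c).length
  sides_pos c := List.length_pos_iff.2 fun h => P.nil_notMem (h ▸ P.cellWord_mem c)
  bdry c i := (P.cellStart c * P.eval ((P.cellWord c).take i), (P.cellWord c).get i)
  bdry_closed c i := P.loop_closed _ _ (P.eval_relator _ (P.cellWord_mem c)) i

/-! ### Van Kampen diagrams -/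

/-- A van Kampen diagram for the word `w`: a finite, planar, contractible combinatorial 2-complex
with directed edges labelled by letters, every 2-cell having its boundary labelled by a relator,
whose boundary circuit, read from the basepoint, is the edge path `path` with label `w`.

That `path` is the boundary circuit of the diagram embedded in the plane by `ι` is expressed by the
map `Φ`: it is continuous on `{1 ≤ ‖z‖}`, maps `{1 < ‖z‖}` homeomorphically onto the complement of
the diagram, and runs along `path` on the unit circle. (A continuous bijection between open subsets
of the plane is a homeomorphism. Since the embedding may be composed with a reflection, asking
for the counterclockwise direction would make no difference.) -/
structure VanKampenDiagram (w : List P.A) where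
  K : TwoComplex.{0}
  finite_V : Finite K.V
  finite_E : Finite K.E
  finite_F : Finite K.F
  contractible : ContractibleSpace K.Realization
  label : K.E → P.A
  label_rev : ∀ e, label (K.rev e) = P.inv (label e)
  face_label : ∀ f, List.ofFn (fun i => label (K.bdry f i)) ∈ P.R
  base : K.V
  path : List K.E
  isPath : K.IsPath base path base
  path_label : path.map label = w
  planar : ∃ ι : K.Realization → ℂ, Topology.IsEmbedding ι ∧
    ∃ Φ : ℂ → ℂ, ContinuousOn Φ {z | 1 ≤ ‖z‖} ∧
      BijOn Φ {z | 1 < ‖z‖} (range ι)ᶜ ∧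
      (path = [] → ∀ z : ℂ, ‖z‖ = 1 → Φ z = ι (K.vtx base)) ∧
      ∀ (i : Fin path.length) (s : unitInterval),
        Φ (Complex.exp (2 * (Real.pi : ℂ) * Complex.I *
          ((((i : ℕ) : ℝ) + (s : ℝ)) / (path.length : ℝ) : ℝ))) = ι (K.edge (path.get i) s)

namespace VanKampenDiagram

variable {P} {w : List P.A} (D : P.VanKampenDiagram w)

/-- The boundary `∂D`, as a subset of the realization. -/
def boundary : Set D.K.Realization := {D.K.vtx D.base} ∪ ⋃ e ∈ D.path, range (D.K.edge e)

/-- `q` is the cellular map from the diagram to the Cayley complex that takes the basepoint to the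
identity vertex and takes vertices to vertices, edges to edges, and open 2-cells bijectively
to open 2-cells, preserving edge and 2-cell boundary labels and directions. (Such a map always
exists, and it is unique up to reparametrization inside the 2-cells.) -/
structure IsProjection (q : D.K.Realization → P.cayley.Realization) : Prop where
  continuous : Continuous q
  base : q (D.K.vtx D.base) = P.cayley.vtx (1 : G)
  vertex : ∀ v, ∃ g : G, q (D.K.vtx v) = P.cayley.vtx g
  edge : ∀ e, ∃ g : G, ∀ t, q (D.K.edge e t) = P.cayley.edge (g, D.label e) t
  face : ∀ f, ∃ g : G,
    q (D.K.vtx (D.K.src (D.K.bdry f ⟨0, D.K.sides_pos f⟩))) = P.cayley.vtx g ∧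
    BijOn q (D.K.openFace f) (P.cayley.openFace (P.cell g _ (D.face_label f)))

end VanKampenDiagram

/-- `f` (a nondecreasing self-map of the set of nonnegative multiples of `1/4`) is an extrinsic
tame filling function over the presentation `P`. -/
def IsExtrinsicTameFilling (f : ℚ → ℚ) : Prop :=
  MapsTo f quarterNat quarterNat ∧ MonotoneOn f quarterNat ∧
  ∀ w : List P.A, P.eval w = 1 →
    ∃ (D : P.VanKampenDiagram w) (q : D.K.Realization → P.cayley.Realization)
      (ψ : D.boundary × unitInterval → D.K.Realization),
      D.IsProjection q ∧ D.K.IsOneCombing D.boundary D.base ψ ∧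
      P.cayley.IsTame (1 : G) f (q ∘ ψ)

end SymPresentation

/-- The 1-combing `ψ` of `(K, K¹)` is tame: for each compact `C` there is a compact `D` such that for
every closed 0- or 1-cell `τ`, the set `ψ⁻¹(C) ∩ (τ × [0,1])` is contained in a single path
component of `ψ⁻¹(D) ∩ (τ × [0,1])`. -/
def TwoComplex.IsTameCombing (K : TwoComplex.{u})
    (ψ : K.skel1 × unitInterval → K.Realization) : Prop :=
  ∀ C : Set K.Realization, IsCompact C → ∃ D : Set K.Realization, IsCompact D ∧
    ∀ τ : Set K.Realization, ((∃ v, τ = {K.vtx v}) ∨ (∃ e, τ = range (K.edge e))) →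
      ∀ x ∈ ψ ⁻¹' C ∩ {z | z.1.1 ∈ τ}, ∀ y ∈ ψ ⁻¹' C ∩ {z | z.1.1 ∈ τ},
        JoinedIn (ψ ⁻¹' D ∩ {z | z.1.1 ∈ τ}) x y

/-- `G` is tame combable: the Cayley complex of some finite presentation of `G` has a tame
1-combing based at the identity. -/
def TameCombable (G : Type u) [Group G] : Prop :=
  ∃ (P : SymPresentation G) (ψ : P.cayley.skel1 × unitInterval → P.cayley.Realization),
    P.cayley.IsOneCombing P.cayley.skel1 (1 : G) ψ ∧ P.cayley.IsTameCombing ψ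

/-! Fix a geodesic edge path from the identity to every vertex of the Cayley complex `X`. An edge
`e` together with the geodesics to its two ends forms a loop whose label represents the identity, so
the filling function supplies a van Kampen diagram for it, and the 1-combing of that diagram
projects to a combing of the whole loop in `X`. Restricting it to `e` would not do: the diagrams of
different edges at a common vertex need not induce the same path there.

The remedy is to stretch the parameter `u` of the edge over the entire loop. In the first half of
the time the point `u` follows the projected combing to the point at proportion `u` of the loop; in
the second half it slides along the loop to the point `u` of `e`. For `u = 0` and `u = 1` the loop
is met at the basepoint, where the combing rests, so only the slide along a chosen geodesic remains.
This path depends on the vertex alone, hence the edge combings glue (`exists_edge_combing`,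
`exists_continuous_skel1`).

Sliding towards `e` follows a nearly geodesic path away from the identity, so going back in time
raises the coarse distance by at most 5 (`coarseDist_walk_slide_le`); in the first half the tameness
by `f` applies. Thus if the combing is at distance at most `N` at some time, it was within `max (f
(N + 5)) (N + 5)` at all earlier times.

Compact sets have bounded coarse distance, and sublevel sets of the coarse distance lie in compact
sets. Given `C`, this yields `D` such that every point of the preimage of `C` over a cell descends
vertically inside the preimage of `D` to time 0. There the combing is constant, so all these points
lie in one path component. -/

namespace TwoComplex

variable (K : TwoComplex.{u})

/-! ### Characteristic maps of the cells. -/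

theorem edge_zero (e : K.E) : K.edge e 0 = K.vtx (K.src e) := Quot.sound (.edge_zero e)

theorem edge_rev_symm (e : K.E) (t : unitInterval) :
    K.edge (K.rev e) (unitInterval.symm t) = K.edge e t :=
  (Quot.sound (.edge_rev e t)).symm

theorem edge_one (e : K.E) : K.edge e 1 = K.vtx (K.tgt e) := by
  rw [← K.edge_rev_symm e 1, unitInterval.symm_one, edge_zero]
  rfl

theorem tgt_rev (e : K.E) : K.tgt (K.rev e) = K.src e := by rw [tgt, K.rev_rev]

theorem face_one (f : K.F) (i : Fin (K.sides f)) (s : unitInterval) :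
    K.face f i s 1 = K.edge (K.bdry f i) s := Quot.sound (.face_bdry f i s)

/-! ### The weak topology -/

theorem continuous_realization_iff {Y : Type*} [TopologicalSpace Y] {g : K.Realization → Y} :
    Continuous g ↔ (∀ e, Continuous fun t => g (K.edge e t)) ∧
      ∀ f i, Continuous fun p : unitInterval × unitInterval => g (K.face f i p.1 p.2) :=
  continuous_sup_dom.trans (and_congr
    (continuous_iSup_dom.trans (forall_congr' fun _ => continuous_coinduced_dom))
    (continuous_iSup_dom.trans (forall_congr' fun _ =>
      continuous_iSup_dom.trans (forall_congr' fun _ => continuous_coinduced_dom))))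

theorem continuous_edge (e : K.E) : Continuous (K.edge e) :=
  (K.continuous_realization_iff.1 continuous_id).1 e

theorem continuous_face (f : K.F) (i : Fin (K.sides f)) :
    Continuous fun p : unitInterval × unitInterval => K.face f i p.1 p.2 :=
  (K.continuous_realization_iff.1 continuous_id).2 f i

theorem isClosed_of_preimages {S : Set K.Realization} (he : ∀ e, IsClosed (K.edge e ⁻¹' S))
    (hf : ∀ f i, IsClosed {p : unitInterval × unitInterval | K.face f i p.1 p.2 ∈ S}) :
    IsClosed S := by
  rw [← isOpen_compl_iff]
  refine isOpen_sup.2 ⟨isOpen_iSup_iff.2 fun e => ?_,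
    isOpen_iSup_iff.2 fun f => isOpen_iSup_iff.2 fun i => ?_⟩
  · exact isOpen_coinduced.2 (he e).isOpen_compl
  · exact isOpen_coinduced.2 (hf f i).isOpen_compl

theorem vtx_mem_skel1 (v : K.V) : K.vtx v ∈ K.skel1 := Or.inl ⟨v, rfl⟩

theorem edge_mem_skel1 (e : K.E) (t : unitInterval) : K.edge e t ∈ K.skel1 :=
  Or.inr (mem_iUnion.2 ⟨e, t, rfl⟩)

theorem face_mem_skel1_iff (f : K.F) (i : Fin (K.sides f)) (s r : unitInterval) :
    K.face f i s r ∈ K.skel1 ↔ r = 1 := by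
  constructor
  · let P : K.PrePoint → Prop := fun
      | .vtx _ => True
      | .edge _ _ => True
      | .face _ _ _ r => r = 1
    have hP : ∀ a b, K.Glue a b → P a = P b := by
      intro a b h
      cases h <;> simp [P]
    let Q : K.Realization → Prop := Quot.lift P hP
    have hQ : ∀ x ∈ K.skel1, Q x := by
      rintro x (⟨v, rfl⟩ | hx)
      · exact trivial
      · obtain ⟨e, t, rfl⟩ := mem_iUnion.1 hx
        exact trivial
    exact fun h => hQ _ h
  · rintro rfl
    rw [face_one]
    exact K.edge_mem_skel1 _ _

/-- A map on the 1-skeleton is continuous as soon as it is continuous along every edge. -/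
theorem continuous_skel1_dom {Y : Type*} [TopologicalSpace Y] {φ : K.skel1 → Y}
    (h : ∀ e, Continuous fun t => φ ⟨K.edge e t, K.edge_mem_skel1 e t⟩) : Continuous φ := by
  refine continuous_iff_isClosed.2 fun S hS => ?_
  -- Closedness is tested in the whole complex, whose topology is given by the characteristic maps;
  -- a polygon meets the set only in its outer boundary, where it reduces to the edge case.
  have key : IsClosed (Subtype.val '' (φ ⁻¹' S)) := by
    have hmem : ∀ e t, K.edge e t ∈ Subtype.val '' (φ ⁻¹' S) ↔
        φ ⟨K.edge e t, K.edge_mem_skel1 e t⟩ ∈ S := fun e t =>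
      ⟨fun ⟨x, hx, hxe⟩ => by simpa [← hxe] using hx, fun hx => ⟨_, hx, rfl⟩⟩
    refine K.isClosed_of_preimages (fun e => ?_) fun f i => ?_
    · convert hS.preimage (h e) using 1
      exact Set.ext fun t => hmem e t
    · have : {p : unitInterval × unitInterval | K.face f i p.1 p.2 ∈ Subtype.val '' (φ ⁻¹' S)} =
          {p | p.2 = 1} ∩
            {p | φ ⟨K.edge (K.bdry f i) p.1, K.edge_mem_skel1 _ _⟩ ∈ S} := by
        ext ⟨s, r⟩
        constructor
        · intro (hx : K.face f i s r ∈ Subtype.val '' (φ ⁻¹' S))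
          obtain rfl : r = 1 := by
            obtain ⟨x, -, hx⟩ := hx
            exact (K.face_mem_skel1_iff f i s r).1 (hx ▸ x.2)
          rw [face_one, hmem] at hx
          exact ⟨rfl, hx⟩
        · rintro ⟨hr, hx⟩
          obtain rfl : r = 1 := hr
          change K.face f i s 1 ∈ Subtype.val '' (φ ⁻¹' S)
          rwa [face_one, hmem]
      rw [this]
      exact (isClosed_eq continuous_snd continuous_const).inter
        (hS.preimage ((h _).comp continuous_fst))
  have := key.preimage (continuous_subtype_val (p := (· ∈ K.skel1)))
  rwa [preimage_image_eq _ Subtype.val_injective] at this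

/-- Paths indexed by the edges with matching end values glue to a continuous map on the
1-skeleton. Of the two directed edges that form an edge, only one is used. -/
theorem exists_continuous_skel1 {Y : Type*} [TopologicalSpace Y] [Inhabited Y] (V : K.V → Y)
    (H : K.E → C(unitInterval, Y)) (h0 : ∀ e, H e 0 = V (K.src e))
    (h1 : ∀ e, H e 1 = V (K.tgt e)) :
    ∃ φ : C(K.skel1, Y), (∀ v, φ ⟨K.vtx v, K.vtx_mem_skel1 v⟩ = V v) ∧
      ∀ e t, ∃ e' t', K.edge e t = K.edge e' t' ∧
        φ ⟨K.edge e t, K.edge_mem_skel1 e t⟩ = H e' t' := by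
  classical
  -- `H e` and `H (rev e)` need not be reverses of each other, so a well-ordering selects one
  -- direction of each edge.
  let H' : K.E → unitInterval → Y := fun e t =>
    if WellOrderingRel e (K.rev e) then H e t else H (K.rev e) (unitInterval.symm t)
  have hrev : ∀ e t, H' e t = H' (K.rev e) (unitInterval.symm t) := by
    intro e t
    simp only [H', K.rev_rev, unitInterval.symm_symm]
    rcases trichotomous_of WellOrderingRel e (K.rev e) with h | h | h
    · rw [if_pos h, if_neg (asymm h)]
    · exact absurd h.symm (K.rev_ne e)
    · rw [if_neg (asymm h), if_pos h]
  have hz : ∀ e, H' e 0 = V (K.src e) := by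
    intro e
    by_cases h : WellOrderingRel e (K.rev e)
    · simp [H', h, h0]
    · simp [H', h, h1, tgt_rev]
  have ho : ∀ e, H' e 1 = V (K.tgt e) := by
    intro e
    rw [hrev, unitInterval.symm_one, hz]
    rfl
  let Θ : K.PrePoint → Y := fun
    | .vtx v => V v
    | .edge e t => H' e t
    -- The default value is taken only on open 2-cells, off the 1-skeleton.
    | .face f i s r => if r = 1 then H' (K.bdry f i) s else default
  have hΘ : ∀ a b, K.Glue a b → Θ a = Θ b := by
    intro a b h
    cases h with
    | edge_zero e => exact hz e
    | edge_rev e t => exact hrev e t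
    | face_centre f i j s t => simp [Θ]
    | face_side f i r =>
      by_cases hr : r = 1
      · simp only [Θ, hr, if_true, ho, hz]
        exact congrArg V (K.bdry_closed f i)
      · simp [Θ, hr]
    | face_bdry f i s => simp [Θ]
  refine ⟨⟨fun x => Quot.lift Θ hΘ x.1, K.continuous_skel1_dom fun e => ?_⟩, fun v => rfl,
    fun e t => ?_⟩
  · change Continuous (H' e)
    by_cases h : WellOrderingRel e (K.rev e)
    · simpa only [H', h, if_true] using (H e).continuous
    · simp only [H', h, if_false]
      exact (H (K.rev e)).continuous.comp unitInterval.continuous_symm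
  · change ∃ e' t', _ ∧ H' e t = _
    by_cases h : WellOrderingRel e (K.rev e)
    · exact ⟨e, t, rfl, by simp [H', h]⟩
    · exact ⟨K.rev e, unitInterval.symm t, (K.edge_rev_symm e t).symm, by simp [H', h]⟩

/-! ### Edge paths -/

variable {K}

theorem IsPath.append {u v w : K.V} {l l' : List K.E} (h : K.IsPath u l v)
    (h' : K.IsPath v l' w) : K.IsPath u (l ++ l') w := by
  induction l generalizing u with
  | nil => obtain rfl : u = v := h; exact h'
  | cons e l ih => exact ⟨h.1, ih h.2⟩

theorem isPath_singleton (e : K.E) : K.IsPath (K.src e) [e] (K.tgt e) := ⟨rfl, rfl⟩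

theorem isPath_rev_singleton (e : K.E) : K.IsPath (K.tgt e) [K.rev e] (K.src e) :=
  ⟨rfl, K.tgt_rev e⟩

theorem IsPath.reverse {u v : K.V} {l : List K.E} (h : K.IsPath u l v) :
    K.IsPath v (l.map K.rev).reverse u := by
  induction l generalizing u with
  | nil => exact Eq.symm h
  | cons e l ih =>
    rw [List.map_cons, List.reverse_cons]
    exact (ih h.2).append (h.1 ▸ isPath_rev_singleton e)

variable (K)

/-- The point at position `x` of the edge path `l` starting at `u`, where every edge has
length one; positions outside of `[0, l.length]` are moved to the nearer end. -/
noncomputable def walk : K.V → List K.E → ℝ → K.Realization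
  | u, [], _ => K.vtx u
  | _, e :: l, x =>
      if x ≤ 1 then K.edge e (projIcc 0 1 zero_le_one x) else walk (K.tgt e) l (x - 1)

variable {K}

theorem walk_of_nonpos {u v : K.V} {l : List K.E} (h : K.IsPath u l v) {x : ℝ} (hx : x ≤ 0) :
    K.walk u l x = K.vtx u := by
  cases l with
  | nil => rfl
  | cons e l =>
    rw [walk, if_pos (hx.trans zero_le_one), projIcc_of_le_left _ hx, ← h.1]
    exact K.edge_zero e

theorem walk_cons_of_one_le {u v : K.V} {e : K.E} {l : List K.E} (h : K.IsPath u (e :: l) v)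
    {x : ℝ} (hx : 1 ≤ x) : K.walk u (e :: l) x = K.walk (K.tgt e) l (x - 1) := by
  rcases hx.eq_or_lt with rfl | hx
  · rw [walk, if_pos le_rfl, walk_of_nonpos h.2 (by simp), projIcc_right]
    exact K.edge_one e
  · rw [walk, if_neg hx.not_ge]

theorem walk_of_length_le {u v : K.V} {l : List K.E} (h : K.IsPath u l v) {x : ℝ}
    (hx : l.length ≤ x) : K.walk u l x = K.vtx v := by
  induction l generalizing u x with
  | nil => exact congrArg K.vtx h
  | cons e l ih =>
    push_cast [List.length_cons] at hx
    rw [walk_cons_of_one_le h (by linarith [l.length.cast_nonneg (α := ℝ)])]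
    exact ih h.2 (by linarith)

theorem walk_singleton (e : K.E) (u : K.V) (x : ℝ) :
    K.walk u [e] x = K.edge e (projIcc 0 1 zero_le_one x) := by
  rcases le_or_gt x 1 with hx | hx
  · rw [walk, if_pos hx]
  · rw [walk, if_neg hx.not_ge, projIcc_of_right_le _ hx.le, walk]
    exact (K.edge_one e).symm

theorem continuous_walk {u v : K.V} {l : List K.E} (h : K.IsPath u l v) :
    Continuous (K.walk u l) := by
  induction l generalizing u with
  | nil => exact continuous_const
  | cons e l ih =>
    simp only [funext fun x => show K.walk u (e :: l) x = if x ≤ 1 then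
      K.edge e (projIcc 0 1 zero_le_one x) else K.walk (K.tgt e) l (x - 1) from rfl]
    refine Continuous.if_le ((K.continuous_edge e).comp continuous_projIcc)
      ((ih h.2).comp (continuous_id.sub continuous_const)) continuous_id continuous_const ?_
    rintro x rfl
    rw [walk_of_nonpos h.2 (by simp), projIcc_right]
    exact K.edge_one e

theorem walk_append_left {u v w : K.V} {l l' : List K.E} (h : K.IsPath u l v)
    (h' : K.IsPath v l' w) {x : ℝ} (hx : x ≤ l.length) :
    K.walk u (l ++ l') x = K.walk u l x := by
  induction l generalizing u x with
  | nil =>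
    obtain rfl : u = v := h
    exact walk_of_nonpos h' (by simpa using hx)
  | cons e l ih =>
    push_cast [List.length_cons] at hx
    rw [List.cons_append, walk, walk, ih h.2 (by linarith)]

theorem walk_append_right {u v w : K.V} {l l' : List K.E} (h : K.IsPath u l v)
    (h' : K.IsPath v l' w) {x : ℝ} (hx : l.length ≤ x) :
    K.walk u (l ++ l') x = K.walk v l' (x - l.length) := by
  induction l generalizing u x with
  | nil =>
    obtain rfl : u = v := h
    simp
  | cons e l ih =>
    push_cast [List.length_cons] at hx ⊢
    have := l.length.cast_nonneg (α := ℝ)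
    rw [List.cons_append, walk_cons_of_one_le (l := l ++ l') (h.append h') (by linarith),
      ih h.2 (by linarith)]
    congr 1
    ring

theorem walk_reverse {u v : K.V} {l : List K.E} (h : K.IsPath u l v) (x : ℝ) :
    K.walk v (l.map K.rev).reverse x = K.walk u l (l.length - x) := by
  induction l generalizing u x with
  | nil => exact congrArg K.vtx (Eq.symm h)
  | cons e l ih =>
    obtain ⟨rfl, h2⟩ := h
    have hlen : ((l.map K.rev).reverse.length : ℝ) = l.length := by simp
    push_cast [List.map_cons, List.reverse_cons, List.length_cons]
    rcases le_total x l.length with hx | hx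
    · rw [walk_append_left h2.reverse (isPath_rev_singleton e) (hlen ▸ hx), ih h2,
        walk_cons_of_one_le ⟨rfl, h2⟩ (by linarith)]
      congr 1
      ring
    · rw [walk_append_right h2.reverse (isPath_rev_singleton e) (hlen ▸ hx), hlen,
        walk_singleton, walk, if_pos (by linarith), ← K.edge_rev_symm e]
      congr 1
      ext
      simp only [coe_projIcc, unitInterval.coe_symm_eq]
      grind

theorem walk_mem {u v : K.V} {l : List K.E} (h : K.IsPath u l v) (x : ℝ) :
    K.walk u l x ∈ {K.vtx u} ∪ ⋃ e ∈ l, range (K.edge e) := by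
  induction l generalizing u x with
  | nil => exact Or.inl rfl
  | cons e l ih =>
    right
    rw [walk]
    split_ifs with hx
    · exact mem_iUnion₂.2 ⟨e, List.mem_cons_self, mem_range_self _⟩
    · rcases ih h.2 (x - 1) with h' | h'
      · exact mem_iUnion₂.2 ⟨e, List.mem_cons_self, 1, by rw [h', K.edge_one]⟩
      · obtain ⟨e', he', h'⟩ := mem_iUnion₂.1 h'
        exact mem_iUnion₂.2 ⟨e', List.mem_cons_of_mem _ he', h'⟩

theorem walk_mem_skel1 {u v : K.V} {l : List K.E} (h : K.IsPath u l v) (x : ℝ) :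
    K.walk u l x ∈ K.skel1 := by
  rcases walk_mem h x with h' | h'
  · exact h' ▸ K.vtx_mem_skel1 u
  · obtain ⟨e, -, t, ht⟩ := mem_iUnion₂.1 h'
    exact ht ▸ K.edge_mem_skel1 e t

/-! ### The path metric and the coarse distance -/

theorem vdist_le_length {u v : K.V} {l : List K.E} (h : K.IsPath u l v) :
    K.vdist u v ≤ l.length := Nat.sInf_le ⟨l, rfl, h⟩

theorem exists_isPath_length_eq_vdist {u v : K.V} (h : ∃ l, K.IsPath u l v) :
    ∃ l, K.IsPath u l v ∧ l.length = K.vdist u v := by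
  obtain ⟨l, hl⟩ := h
  obtain ⟨l', h1, h2⟩ := Nat.sInf_mem (s := {n | ∃ l : List K.E, l.length = n ∧ K.IsPath u l v})
    ⟨_, l, rfl, hl⟩
  exact ⟨l', h2, h1⟩

theorem vdist_self (u : K.V) : K.vdist u u = 0 :=
  Nat.le_zero.1 (vdist_le_length (l := []) rfl)

variable (K) in
/-- Any two vertices are joined by an edge path. -/
def EdgeConnected : Prop := ∀ u v, ∃ l, K.IsPath u l v

theorem EdgeConnected.vdist_le_add (hK : K.EdgeConnected) (y : K.V) {u v : K.V} {l : List K.E}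
    (h : K.IsPath u l v) : K.vdist y v ≤ K.vdist y u + l.length := by
  obtain ⟨l', h', hl'⟩ := exists_isPath_length_eq_vdist (hK y u)
  simpa [hl'] using vdist_le_length (h'.append h)

theorem EdgeConnected.vdist_tgt_le (hK : K.EdgeConnected) (y : K.V) (e : K.E) :
    K.vdist y (K.tgt e) ≤ K.vdist y (K.src e) + 1 :=
  hK.vdist_le_add y (isPath_singleton e)

theorem EdgeConnected.vdist_src_le (hK : K.EdgeConnected) (y : K.V) (e : K.E) :
    K.vdist y (K.src e) ≤ K.vdist y (K.tgt e) + 1 :=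
  hK.vdist_le_add y (isPath_rev_singleton e)

theorem coarseDist_vtx (y v : K.V) : K.coarseDist y (K.vtx v) = K.vdist y v := rfl

/-- The coarse distance from `u` respects the gluing and, by connectedness, vanishes at no vertex
other than `u`. -/
theorem EdgeConnected.vtx_injective (hK : K.EdgeConnected) : Function.Injective K.vtx := by
  intro u v h
  have h0 : K.vdist u v = 0 := by
    have := congrArg (K.coarseDist u) h
    rw [coarseDist_vtx, coarseDist_vtx, vdist_self] at this
    exact_mod_cast this.symm
  obtain ⟨l, hl, hl0⟩ := exists_isPath_length_eq_vdist (hK u v)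
  rw [h0, List.length_eq_zero_iff] at hl0
  subst hl0
  exact hl

theorem EdgeConnected.abs_edgeLevel_sub_le (hK : K.EdgeConnected) (y : K.V) (e : K.E) :
    |K.edgeLevel y e - K.vdist y (K.src e)| ≤ 1 := by
  have h1 : (K.vdist y (K.tgt e) : ℚ) ≤ K.vdist y (K.src e) + 1 := mod_cast hK.vdist_tgt_le y e
  have h2 : (K.vdist y (K.src e) : ℚ) ≤ K.vdist y (K.tgt e) + 1 := mod_cast hK.vdist_src_le y e
  rw [edgeLevel, abs_le]
  rcases min_choice (K.vdist y (K.src e) : ℚ) (K.vdist y (K.tgt e)) with h | h <;>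
    constructor <;> linarith [min_le_left (K.vdist y (K.src e) : ℚ) (K.vdist y (K.tgt e))]

theorem EdgeConnected.abs_coarseDist_edge_sub_le (hK : K.EdgeConnected) (y : K.V) (e : K.E)
    (t : unitInterval) : |K.coarseDist y (K.edge e t) - K.vdist y (K.src e)| ≤ 1 := by
  have h1 : (K.vdist y (K.tgt e) : ℚ) ≤ K.vdist y (K.src e) + 1 := mod_cast hK.vdist_tgt_le y e
  have h2 : (K.vdist y (K.src e) : ℚ) ≤ K.vdist y (K.tgt e) + 1 := mod_cast hK.vdist_src_le y e
  change |K.edgePtLevel y e t - _| ≤ 1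
  rw [edgePtLevel]
  split_ifs
  · simp
  · rw [abs_le]
    constructor <;> linarith
  · exact hK.abs_edgeLevel_sub_le y e

theorem coarseDist_face {y : K.V} {f : K.F} {i : Fin (K.sides f)} {s r : unitInterval}
    (hr : r ≠ 1) : K.coarseDist y (K.face f i s r) = K.faceLevel y f := by
  change (if r = 1 then _ else _) = _
  rw [if_neg hr]

theorem edgeLevel_le_faceLevel (y : K.V) (f : K.F) (i : Fin (K.sides f)) :
    K.edgeLevel y (K.bdry f i) ≤ K.faceLevel y f + 1 / 4 := by
  rw [faceLevel, sub_add_cancel]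
  exact Finset.le_sup' (fun i => K.edgeLevel y (K.bdry f i)) (Finset.mem_univ i)

theorem exists_faceLevel_eq (y : K.V) (f : K.F) :
    ∃ i, K.faceLevel y f = K.edgeLevel y (K.bdry f i) - 1 / 4 := by
  obtain ⟨i, -, hi⟩ := Finset.exists_mem_eq_sup' ⟨⟨0, K.sides_pos f⟩, Finset.mem_univ _⟩
    (fun i => K.edgeLevel y (K.bdry f i))
  exact ⟨i, congrArg (· - 1 / 4) hi⟩

theorem edgeLevel_eq (y : K.V) (e : K.E) :
    K.edgeLevel y e = (min (K.vdist y (K.src e)) (K.vdist y (K.tgt e)) : ℕ) + 1 / 2 := by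
  rw [edgeLevel, Nat.cast_min]

theorem natCast_mem_quarterNat (n : ℕ) : (n : ℚ) ∈ quarterNat :=
  ⟨4 * n, by push_cast; ring⟩

theorem edgePtLevel_mem_quarterNat (y : K.V) (e : K.E) (t : unitInterval) :
    K.edgePtLevel y e t ∈ quarterNat := by
  rw [edgePtLevel]
  split_ifs
  · exact natCast_mem_quarterNat _
  · exact natCast_mem_quarterNat _
  · rw [edgeLevel_eq]
    exact ⟨4 * min (K.vdist y (K.src e)) (K.vdist y (K.tgt e)) + 2, by push_cast; ring⟩

theorem coarseDist_mem_quarterNat (y : K.V) (x : K.Realization) :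
    K.coarseDist y x ∈ quarterNat := by
  obtain ⟨v | ⟨e, t⟩ | ⟨f, i, s, r⟩⟩ := x
  · exact natCast_mem_quarterNat _
  · exact edgePtLevel_mem_quarterNat y e t
  · by_cases hr : r = 1
    · subst hr
      change K.coarseDist y (K.face f i s 1) ∈ _
      rw [face_one]
      exact edgePtLevel_mem_quarterNat y _ s
    · change K.coarseDist y (K.face f i s r) ∈ _
      obtain ⟨j, hj⟩ := exists_faceLevel_eq y f
      rw [coarseDist_face hr, hj, edgeLevel_eq]
      exact ⟨4 * min (K.vdist y (K.src (K.bdry f j))) (K.vdist y (K.tgt (K.bdry f j))) + 1, by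
        push_cast; ring⟩

/-- Distance grows at most at unit speed along an edge path; the extra 1 absorbs the jumps of the
coarse distance within an edge. -/
theorem EdgeConnected.coarseDist_walk_le (hK : K.EdgeConnected) (y : K.V) {u v : K.V}
    {l : List K.E} (h : K.IsPath u l v) {x : ℝ} (hx : 0 ≤ x) :
    (K.coarseDist y (K.walk u l x) : ℝ) ≤ K.vdist y u + x + 1 := by
  induction l generalizing u x with
  | nil =>
    rw [walk, coarseDist_vtx, Rat.cast_natCast]
    linarith
  | cons e l ih =>
    obtain ⟨rfl, h2⟩ := h
    rcases le_total x 1 with hx1 | hx1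
    · rw [walk, if_pos hx1]
      have := (abs_le.1 (hK.abs_coarseDist_edge_sub_le y e (projIcc 0 1 zero_le_one x))).2
      rify at this
      linarith
    · rw [walk_cons_of_one_le ⟨rfl, h2⟩ hx1]
      have h1 := hK.vdist_tgt_le y e
      rify at h1
      linarith [ih h2 (x := x - 1) (by linarith)]

/-- The rest of the path leads to `v`. The slack 2 is one unit for the passage to the start of the
current edge and one for the part of that edge already covered. -/
theorem EdgeConnected.vdist_le_coarseDist_walk (hK : K.EdgeConnected) (y : K.V) {u v : K.V}
    {l : List K.E} (h : K.IsPath u l v) {x : ℝ} (hx : x ≤ l.length) :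
    (K.vdist y v : ℝ) ≤ K.coarseDist y (K.walk u l x) + (l.length - x) + 2 := by
  induction l generalizing u x with
  | nil =>
    obtain rfl : u = v := h
    rw [walk, coarseDist_vtx, Rat.cast_natCast]
    linarith
  | cons e l ih =>
    have h3 := hK.vdist_le_add y h
    obtain ⟨rfl, h2⟩ := h
    rcases le_total x 1 with hx1 | hx1
    · rw [walk, if_pos hx1]
      have := (abs_le.1 (hK.abs_coarseDist_edge_sub_le y e (projIcc 0 1 zero_le_one x))).1
      rify at this h3
      linarith
    · rw [walk_cons_of_one_le ⟨rfl, h2⟩ hx1]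
      push_cast [List.length_cons] at hx ⊢
      linarith [ih h2 (x := x - 1) (by linarith)]

/-- Along a path from `y` that is two steps from being geodesic, the coarse distance is
increasing up to an additive constant. -/
theorem EdgeConnected.coarseDist_walk_le_add (hK : K.EdgeConnected) {y v : K.V}
    {l : List K.E} (h : K.IsPath y l v) (hl : l.length ≤ K.vdist y v + 2) {x x' : ℝ} (hx : 0 ≤ x)
    (hxx' : x ≤ x') (hx' : x' ≤ l.length) :
    K.coarseDist y (K.walk y l x) ≤ K.coarseDist y (K.walk y l x') + 5 := by
  -- The constant is 5 = 1 + 2 + 2: the errors of the upper and the lower estimate, and the defect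
  -- of the path from being geodesic.
  have h1 := hK.coarseDist_walk_le y h hx
  have h2 := hK.vdist_le_coarseDist_walk y h hx'
  rw [vdist_self] at h1
  rify at hl h1 ⊢
  linarith

/-- The coarse distance is bounded on compact sets if the distances from the vertices of a 2-cell
to the base vertex differ by a bounded amount. -/
theorem EdgeConnected.exists_coarseDist_le_of_isCompact (hK : K.EdgeConnected) (y : K.V)
    (c : K.F → ℕ) (L : ℕ) (hL : ∀ f i, K.vdist y (K.src (K.bdry f i)) ≤ c f + L)
    (hL' : ∀ f i, c f ≤ K.vdist y (K.src (K.bdry f i)) + L)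
    {C : Set K.Realization} (hC : IsCompact C) :
    ∃ N : ℕ, ∀ x ∈ C, K.coarseDist y x ≤ N := by
  -- The coarse distance is not continuous, so it is compared with a continuous function: linear on
  -- edges, and on each polygon the cone from the value `c f` at the centre.
  let he : K.E → unitInterval → ℝ := fun e t =>
    (1 - t) * K.vdist y (K.src e) + t * K.vdist y (K.tgt e)
  let h₀ : K.PrePoint → ℝ := fun
    | .vtx v => K.vdist y v
    | .edge e t => he e t
    | .face f i s r => r * he (K.bdry f i) s + (1 - r) * c f
  have hglue : ∀ a b, K.Glue a b → h₀ a = h₀ b := by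
    intro a b h
    cases h with
    | edge_zero e => simp [h₀, he]
    | edge_rev e t =>
      simp only [h₀, he, K.rev_rev, unitInterval.coe_symm_eq, tgt]
      ring
    | face_centre f i j s t => simp [h₀]
    | face_side f i r => simp [h₀, he, tgt, K.bdry_closed]
    | face_bdry f i s => simp [h₀]
  let η : K.Realization → ℝ := Quot.lift h₀ hglue
  have hecont : ∀ e, Continuous (he e) := fun e => by fun_prop
  have hη : Continuous η := by
    refine K.continuous_realization_iff.2 ⟨hecont, fun f i => ?_⟩
    change Continuous fun p : unitInterval × unitInterval =>
      (p.2 : ℝ) * he (K.bdry f i) p.1 + (1 - p.2) * c f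
    have := hecont (K.bdry f i)
    fun_prop
  have hedge : ∀ e t, |he e t - K.vdist y (K.src e)| ≤ 1 := by
    intro e t
    have h1 := hK.vdist_tgt_le y e
    have h2 := hK.vdist_src_le y e
    rify at h1 h2
    have : he e t - K.vdist y (K.src e) = t * (K.vdist y (K.tgt e) - K.vdist y (K.src e)) := by
      simp only [he]; ring
    rw [this, abs_mul, abs_of_nonneg t.2.1]
    exact mul_le_one₀ t.2.2 (abs_nonneg _) (abs_le.2 ⟨by linarith, by linarith⟩)
  have hedge' : ∀ e t, (K.coarseDist y (K.edge e t) : ℝ) ≤ he e t + 2 := by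
    intro e t
    have h1 := (abs_le.1 (hK.abs_coarseDist_edge_sub_le y e t)).2
    have h2 := (abs_le.1 (hedge e t)).1
    rify at h1
    linarith
  have hle : ∀ x, (K.coarseDist y x : ℝ) ≤ η x + 2 * L + 2 := by
    rintro ⟨v | ⟨e, t⟩ | ⟨f, i, s, r⟩⟩
    · change ((K.vdist y v : ℚ) : ℝ) ≤ K.vdist y v + 2 * L + 2
      push_cast
      linarith [L.cast_nonneg (α := ℝ)]
    · change (K.coarseDist y (K.edge e t) : ℝ) ≤ he e t + 2 * L + 2
      linarith [hedge' e t, L.cast_nonneg (α := ℝ)]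
    · change (K.coarseDist y (K.face f i s r) : ℝ) ≤
        r * he (K.bdry f i) s + (1 - r) * c f + 2 * L + 2
      by_cases hr : r = 1
      · subst hr
        rw [face_one]
        have := hedge' (K.bdry f i) s
        simp only [Icc.coe_one]
        linarith [L.cast_nonneg (α := ℝ)]
      · rw [coarseDist_face hr]
        obtain ⟨j, hj⟩ := exists_faceLevel_eq y f
        have h1 := (abs_le.1 (hK.abs_edgeLevel_sub_le y (K.bdry f j))).2
        have h2 := hL f j
        have h3 := hL' f i
        have h4 := (abs_le.1 (hedge (K.bdry f i) s)).1
        rw [hj]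
        rify at h1 h2 h3 ⊢
        -- On a polygon the comparison function is a convex combination of `c f` and a boundary
        -- value, hence at least `c f - L - 1`, while the level of the 2-cell is below `c f + L +
        -- 1`.
        have h5 : (c f : ℝ) - L - 1 ≤ he (K.bdry f i) s := by linarith
        have h6 := mul_le_mul_of_nonneg_left h5 r.2.1
        have h7 : (r : ℝ) * (L + 1) ≤ 1 * (L + 1) :=
          mul_le_mul_of_nonneg_right r.2.2 (by positivity)
        linarith
  obtain ⟨B, hB⟩ := hC.bddAbove_image hη.continuousOn
  obtain ⟨N, hN⟩ := exists_nat_ge (B + 2 * L + 2)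
  refine ⟨N, fun x hx => ?_⟩
  have h1 := hle x
  have h2 := hB (mem_image_of_mem η hx)
  rify
  linarith

end TwoComplex

namespace SymPresentation

open TwoComplex

variable {G : Type u} [Group G] (P : SymPresentation G)

/-! ### The Cayley complex -/

theorem eval_cons (a : P.A) (w : List P.A) : P.eval (a :: w) = P.rep a * P.eval w := by
  simp [eval]

/-- The vertex of the identity in the Cayley complex. -/
def origin : P.cayley.V := (1 : G)

/-- The label of an edge of the Cayley complex. -/
def edgeLabel (e : P.cayley.E) : P.A := e.2

variable {P} in
theorem eq_mul_eval_of_isPath {g h : G} {l : List P.cayley.E} (hl : P.cayley.IsPath g l h) :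
    h = g * P.eval (l.map P.edgeLabel) := by
  induction l generalizing g with
  | nil =>
    obtain rfl : g = h := hl
    exact (mul_one g).symm
  | cons e l ih =>
    obtain ⟨rfl, h2⟩ := hl
    change h = (e.1 : G) * P.eval (P.edgeLabel e :: l.map P.edgeLabel)
    rw [eval_cons, ← mul_assoc]
    exact ih h2

variable {P} in
theorem eval_map_edgeLabel {h : G} {l : List P.cayley.E} (hl : P.cayley.IsPath P.origin l h) :
    P.eval (l.map P.edgeLabel) = h :=
  ((eq_mul_eval_of_isPath hl).trans (one_mul _)).symm

theorem edgeConnected_cayley : P.cayley.EdgeConnected := by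
  have key : ∀ (x : FreeGroup P.A) (g : G),
      ∃ l, P.cayley.IsPath g l (g * FreeGroup.lift P.rep x : G) := by
    intro x
    induction x using FreeGroup.induction_on with
    | C1 => exact fun g => ⟨[], (by simp : g = _)⟩
    | of a => exact fun g => ⟨[(g, a)], rfl, (by simp : g * P.rep a = _)⟩
    | inv_of a _ =>
      have : P.rep (P.inv a) = (P.rep a)⁻¹ := eq_inv_of_mul_eq_one_right (P.rep_mul_inv a)
      exact fun g => ⟨[(g, P.inv a)], rfl, (by simp [this] : g * P.rep (P.inv a) = _)⟩
    | mul x y hx hy =>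
      intro g
      obtain ⟨l, hl⟩ := hx g
      obtain ⟨l', hl'⟩ := hy (g * FreeGroup.lift P.rep x)
      exact ⟨l ++ l', by simpa [mul_assoc] using hl.append hl'⟩
  intro (g : G) (h : G)
  obtain ⟨x, hx⟩ := P.surj (g⁻¹ * h)
  obtain ⟨l, hl⟩ := key x g
  rw [hx, mul_inv_cancel_left] at hl
  exact ⟨l, hl⟩

theorem finite_ball (n : ℕ) : {g : G | P.cayley.vdist P.origin g ≤ n}.Finite := by
  have := P.finite_A
  refine ((List.finite_length_le P.A n).image P.eval).subset fun g hg => ?_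
  obtain ⟨l, hl, hlen⟩ := exists_isPath_length_eq_vdist (P.edgeConnected_cayley P.origin g)
  refine ⟨l.map P.edgeLabel, ?_, eval_map_edgeLabel hl⟩
  rw [mem_ofPred_eq, List.length_map, hlen]
  exact hg

/-- Sublevel sets of the coarse distance on the Cayley complex are relatively compact. -/
theorem exists_isCompact_sublevel (M : ℚ) :
    ∃ D : Set P.cayley.Realization, IsCompact D ∧
      ∀ x, P.cayley.coarseDist P.origin x ≤ M → x ∈ D := by
  -- The start of an edge with a point of level at most `M` is within `M + 1`; for a 2-cell another
  -- `1 / 4` is lost.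
  obtain ⟨n, hn⟩ := exists_nat_ge (M + 2)
  have := P.finite_A
  have hball := P.finite_ball n
  let B : Set G := {g : G | P.cayley.vdist P.origin g ≤ n}
  let S : Set P.Cell := {c | P.cellStart c ∈ B}
  -- A 2-cell is determined by the start and label of its chosen boundary path; the starts lie in a
  -- finite ball and the relators are finitely many.
  have hS : S.Finite := by
    refine ((hball.prod P.finite_R).preimage
      (f := fun c => (P.cellStart c, P.cellWord c)) ?_).subset fun c hc => ⟨hc, P.cellWord_mem c⟩
    intro c _ c' _ hcc
    have : Quot.out c = Quot.out c' := Subtype.ext hcc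
    exact (Quot.out_eq c).symm.trans ((congrArg (Quot.mk _) this).trans (Quot.out_eq c'))
  have hedge : ∀ e t, P.cayley.coarseDist P.origin (P.cayley.edge e t) ≤ M →
      e ∈ B ×ˢ (univ : Set P.A) := by
    intro e t h
    refine ⟨?_, trivial⟩
    have := (abs_le.1 (P.edgeConnected_cayley.abs_coarseDist_edge_sub_le P.origin e t)).1
    change P.cayley.vdist P.origin (P.cayley.src e) ≤ n
    rify at *
    linarith
  refine ⟨P.cayley.vtx '' B ∪ (⋃ e ∈ B ×ˢ (univ : Set P.A), range (P.cayley.edge e)) ∪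
    ⋃ c ∈ S, ⋃ i, range fun q : unitInterval × unitInterval => P.cayley.face c i q.1 q.2,
    ((hball.image _).isCompact.union ?_).union ?_, ?_⟩
  · exact (hball.prod finite_univ).isCompact_biUnion fun e _ =>
      isCompact_range (P.cayley.continuous_edge e)
  · exact hS.isCompact_biUnion fun c _ => isCompact_iUnion fun i =>
      isCompact_range (P.cayley.continuous_face c i)
  · rintro ⟨g | ⟨e, t⟩ | ⟨c, i, s, r⟩⟩ hx
    · refine Or.inl (Or.inl ⟨g, ?_, rfl⟩)
      change (P.cayley.vdist P.origin g : ℚ) ≤ M at hx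
      change P.cayley.vdist P.origin g ≤ n
      rify at *
      linarith
    · exact Or.inl (Or.inr (mem_iUnion₂.2 ⟨e, hedge e t hx, t, rfl⟩))
    · by_cases hr : r = 1
      · subst hr
        change P.cayley.coarseDist P.origin (P.cayley.face c i s 1) ≤ M at hx
        refine Or.inl (Or.inr (mem_iUnion₂.2 ⟨P.cayley.bdry c i, ?_, s, ?_⟩))
        · rw [face_one] at hx
          exact hedge _ s hx
        · exact (P.cayley.face_one c i s).symm
      · change P.cayley.coarseDist P.origin (P.cayley.face c i s r) ≤ M at hx
        refine Or.inr (mem_iUnion₂.2 ⟨c, ?_, mem_iUnion.2 ⟨i, (s, r), rfl⟩⟩)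
        rw [coarseDist_face hr] at hx
        -- Side 0 issues from `cellStart c`, the vertex that has to be bounded.
        let j : Fin (P.cayley.sides c) := ⟨0, P.cayley.sides_pos c⟩
        have h1 := edgeLevel_le_faceLevel (K := P.cayley) P.origin c j
        have h2 := (abs_le.1 (P.edgeConnected_cayley.abs_edgeLevel_sub_le P.origin
          (P.cayley.bdry c j))).1
        have h3 : P.cayley.src (P.cayley.bdry c j) = P.cellStart c := by
          change P.cellStart c * P.eval ((P.cellWord c).take 0) = _
          simp [eval]
        rw [h3] at h2
        change P.cayley.vdist P.origin (P.cellStart c) ≤ n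
        rify at *
        linarith

/-- Keeps all vertices of a 2-cell within the maximal relator length of its start, as the comparison
with a continuous function requires. -/
theorem exists_isPath_bdry (c : P.Cell) (i : Fin (P.cayley.sides c)) :
    ∃ l, l.length = (i : ℕ) ∧
      P.cayley.IsPath (P.cellStart c) l (P.cayley.src (P.cayley.bdry c i)) := by
  obtain ⟨i, hi⟩ := i
  induction i with
  | zero =>
    refine ⟨[], rfl, ?_⟩
    change P.cellStart c = P.cellStart c * P.eval ((P.cellWord c).take 0)
    simp [eval]
  | succ i ih =>
    have hi' : i < P.cayley.sides c := Nat.lt_of_succ_lt hi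
    obtain ⟨l, hl, hp⟩ := ih hi'
    refine ⟨l ++ [P.cayley.bdry c ⟨i, hi'⟩], by simpa using hl, hp.append ⟨rfl, ?_⟩⟩
    change P.cellStart c * P.eval ((P.cellWord c).take i) * P.rep ((P.cellWord c).get ⟨i, hi'⟩) =
      P.cellStart c * P.eval ((P.cellWord c).take (i + 1))
    rw [mul_assoc]
    exact congrArg _ (P.eval_take_succ (P.cellWord c) ⟨i, hi'⟩)

theorem exists_coarseDist_le_of_isCompact {C : Set P.cayley.Realization} (hC : IsCompact C) :
    ∃ N : ℕ, ∀ x ∈ C, P.cayley.coarseDist P.origin x ≤ N := by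
  obtain ⟨L, hL⟩ := (P.finite_R.image List.length).bddAbove
  have hlen : ∀ (c : P.Cell) (i : Fin (P.cayley.sides c)), (i : ℕ) ≤ L := fun c i =>
    i.2.le.trans (hL ⟨_, P.cellWord_mem c, rfl⟩)
  refine P.edgeConnected_cayley.exists_coarseDist_le_of_isCompact P.origin
    (fun c => P.cayley.vdist P.origin (P.cellStart c)) L (fun c i => ?_) (fun c i => ?_) hC
  · obtain ⟨l, hl, hp⟩ := P.exists_isPath_bdry c i
    have := P.edgeConnected_cayley.vdist_le_add P.origin hp
    have := hlen c i
    omega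
  · obtain ⟨l, hl, hp⟩ := P.exists_isPath_bdry c i
    have h := P.edgeConnected_cayley.vdist_le_add P.origin hp.reverse
    have := hlen c i
    simp only [List.length_reverse, List.length_map] at h
    omega

/-! ### Combings of loops and of single edges. -/

variable {P}

/-- The projection of a van Kampen diagram takes edge paths to edge paths with the same label. -/
theorem VanKampenDiagram.IsProjection.apply_walk {w : List P.A} {D : P.VanKampenDiagram w}
    {q : D.K.Realization → P.cayley.Realization} (hq : D.IsProjection q) {u v : D.K.V} {g h : G}
    {l : List D.K.E} {l' : List P.cayley.E} (hl : D.K.IsPath u l v) (hl' : P.cayley.IsPath g l' h)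
    (hlabel : l'.map P.edgeLabel = l.map D.label) (hu : q (D.K.vtx u) = P.cayley.vtx g) (x : ℝ) :
    q (D.K.walk u l x) = P.cayley.walk g l' x := by
  induction l generalizing u g l' x with
  | nil =>
    obtain rfl : l' = [] := List.map_eq_nil_iff.1 hlabel
    exact hu
  | cons e l ih =>
    obtain _ | ⟨e', l'⟩ := l'
    · exact absurd hlabel (List.cons_ne_nil _ _).symm
    obtain ⟨rfl, h2⟩ := hl
    obtain ⟨rfl, h2'⟩ := hl'
    rw [List.map_cons, List.map_cons, List.cons.injEq] at hlabel
    -- The projection fixes the label of the image edge; its initial vertex is then forced by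
    -- injectivity of `vtx`.
    have he : ∀ t, q (D.K.edge e t) = P.cayley.edge e' t := by
      obtain ⟨g, hg⟩ := hq.edge e
      have h1 : e'.1 = g := by
        refine P.edgeConnected_cayley.vtx_injective (hu.symm.trans ?_)
        rw [← TwoComplex.edge_zero, hg]
        exact P.cayley.edge_zero _
      rw [← hlabel.1, ← h1] at hg
      exact hg
    rw [walk, walk]
    split_ifs
    · exact he _
    · refine ih h2 h2' hlabel.2 ?_ _
      rw [← TwoComplex.edge_one, ← TwoComplex.edge_one, he]

/-- A closed edge path in the Cayley complex and the combing of a diagram for its label. -/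
theorem IsExtrinsicTameFilling.exists_loop_combing {f : ℚ → ℚ} (hf : P.IsExtrinsicTameFilling f)
    {l : List P.cayley.E} (hl : P.cayley.IsPath P.origin l P.origin) :
    ∃ χ : ℝ × unitInterval → P.cayley.Realization, Continuous χ ∧
      (∀ x, χ (x, 0) = P.cayley.vtx P.origin) ∧
      (∀ x, χ (x, 1) = P.cayley.walk P.origin l x) ∧
      (∀ (x : ℝ) t, x ≤ 0 → χ (x, t) = P.cayley.vtx P.origin) ∧
      (∀ (x : ℝ) t, l.length ≤ x → χ (x, t) = P.cayley.vtx P.origin) ∧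
      P.cayley.IsTame P.origin f χ := by
  obtain ⟨D, q, ψ, hq, hψ, ht⟩ := hf.2.2 (l.map P.edgeLabel)
    (eval_map_edgeLabel hl)
  have hlen : D.path.length = l.length := by
    have := congrArg List.length D.path_label
    rwa [List.length_map, List.length_map] at this
  -- The boundary circuit is parametrized by arc length, so that positions match those on `l` in the
  -- Cayley complex.
  let c : ℝ → D.boundary := fun x => ⟨D.K.walk D.base D.path x, walk_mem D.isPath x⟩
  have hc : Continuous c := (continuous_walk D.isPath).subtype_mk _
  have hbase : D.K.vtx D.base ∈ D.boundary := Or.inl rfl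
  have hconst : ∀ x t, D.K.walk D.base D.path x = D.K.vtx D.base →
      (q ∘ ψ) (c x, t) = P.cayley.vtx P.origin := by
    intro x t hx
    have : c x = ⟨D.K.vtx D.base, hbase⟩ := Subtype.ext hx
    rw [Function.comp_apply, this, hψ.base hbase, hq.base]
    rfl
  refine ⟨fun p => (q ∘ ψ) (c p.1, p.2), ?_, fun x => ?_, fun x => ?_, fun x t hx => ?_,
    fun x t hx => ?_, fun x s t hst => ht (c x) s t hst⟩
  · exact (hq.continuous.comp hψ.continuous).comp ((hc.comp continuous_fst).prodMk continuous_snd)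
  · simp only [Function.comp_apply, hψ.zero, hq.base]
    rfl
  · simp only [Function.comp_apply, hψ.one]
    exact hq.apply_walk D.isPath hl D.path_label.symm hq.base x
  · exact hconst x t (walk_of_nonpos D.isPath hx)
  · exact hconst x t (walk_of_length_le D.isPath (hlen ▸ hx))

/-- In a loop formed by two geodesics and an edge joining their end points, the coarse distance is
essentially increasing towards that edge. -/
theorem coarseDist_walk_triangle_le {l₁ l₂ : List P.cayley.E} {e : P.cayley.E}
    (h₁ : P.cayley.IsPath P.origin l₁ (P.cayley.src e))
    (hl₁ : l₁.length = P.cayley.vdist P.origin (P.cayley.src e))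
    (h₂ : P.cayley.IsPath P.origin l₂ (P.cayley.tgt e))
    {x x' : ℝ}
    (hx : 0 ≤ x) (hxx' : x ≤ x') (hx' : x' ≤ l₁.length + 1) :
    P.cayley.coarseDist P.origin
        (P.cayley.walk P.origin (l₁ ++ [e] ++ (l₂.map P.cayley.rev).reverse) x) ≤
      P.cayley.coarseDist P.origin
        (P.cayley.walk P.origin (l₁ ++ [e] ++ (l₂.map P.cayley.rev).reverse) x') + 5 := by
  have hp := h₁.append (isPath_singleton e)
  have hlen : ((l₁ ++ [e]).length : ℝ) = l₁.length + 1 := by simp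
  rw [walk_append_left hp h₂.reverse (hlen ▸ hxx'.trans hx'),
    walk_append_left hp h₂.reverse (hlen ▸ hx')]
  -- The ends of `e` are at distances differing by at most 1, so a geodesic followed by `e` exceeds
  -- a geodesic by at most 2.
  refine P.edgeConnected_cayley.coarseDist_walk_le_add hp ?_ hx hxx' (hlen ▸ hx')
  have := P.edgeConnected_cayley.vdist_src_le P.origin e
  simp only [List.length_append, List.length_singleton]
  omega

/-- As `coarseDist_walk_triangle_le`, for both directions of approaching a point `y` of the edge
from a point `x` of the loop. -/
theorem coarseDist_walk_slide_le {l₁ l₂ : List P.cayley.E} {e : P.cayley.E}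
    (h₁ : P.cayley.IsPath P.origin l₁ (P.cayley.src e))
    (hl₁ : l₁.length = P.cayley.vdist P.origin (P.cayley.src e))
    (h₂ : P.cayley.IsPath P.origin l₂ (P.cayley.tgt e))
    (hl₂ : l₂.length = P.cayley.vdist P.origin (P.cayley.tgt e)) {x y a b : ℝ}
    (hx : 0 ≤ x) (hx' : x ≤ l₁.length + 1 + l₂.length) (hy : l₁.length ≤ y)
    (hy' : y ≤ l₁.length + 1) (ha : 0 ≤ a) (hab : a ≤ b) (hb : b ≤ 1) :
    P.cayley.coarseDist P.origin
        (P.cayley.walk P.origin (l₁ ++ [e] ++ (l₂.map P.cayley.rev).reverse) (x + a * (y - x))) ≤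
      P.cayley.coarseDist P.origin
        (P.cayley.walk P.origin (l₁ ++ [e] ++ (l₂.map P.cayley.rev).reverse) (x + b * (y - x)))
        + 5 := by
  rcases le_total x y with hxy | hxy
  · have h1 := mul_le_mul_of_nonneg_right hab (sub_nonneg.2 hxy)
    have h2 := mul_le_mul_of_nonneg_right hb (sub_nonneg.2 hxy)
    have h3 := mul_nonneg ha (sub_nonneg.2 hxy)
    exact coarseDist_walk_triangle_le h₁ hl₁ h₂ (by linarith) (by linarith) (by linarith)
  · have h1 := mul_le_mul_of_nonneg_right hab (sub_nonneg.2 hxy)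
    have h2 := mul_le_mul_of_nonneg_right hb (sub_nonneg.2 hxy)
    have h3 := mul_nonneg ha (sub_nonneg.2 hxy)
    -- Approaching `e` from its far side is the previous case for the reversed loop, with `l₁` and
    -- `l₂` exchanged.
    have hrev : ∀ z, P.cayley.walk P.origin (l₁ ++ [e] ++ (l₂.map P.cayley.rev).reverse) z =
        P.cayley.walk P.origin (l₂ ++ [P.cayley.rev e] ++ (l₁.map P.cayley.rev).reverse)
          (l₁.length + 1 + l₂.length - z) := by
      intro z
      have hp : P.cayley.IsPath P.origin (l₂ ++ [P.cayley.rev e] ++ (l₁.map P.cayley.rev).reverse)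
          P.origin := (h₂.append (isPath_rev_singleton e)).append h₁.reverse
      have := walk_reverse hp z
      rw [List.map_append, List.map_append, List.map_reverse, List.map_map, List.reverse_append,
        List.reverse_append, List.reverse_reverse, (funext P.cayley.rev_rev :
          P.cayley.rev ∘ P.cayley.rev = id), List.map_id, List.map_singleton, P.cayley.rev_rev,
        List.reverse_singleton, ← List.append_assoc] at this
      rw [this]
      congr 1
      simp only [List.length_append, List.length_reverse, List.length_map, List.length_singleton]
      push_cast
      ring
    rw [hrev, hrev]
    refine coarseDist_walk_triangle_le h₂ hl₂ ((P.cayley.tgt_rev e).symm ▸ h₁) ?_ ?_ ?_ <;>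
      linarith

/-- Tameness over a vertex: the path rests at the origin until time `1 / 2` and follows a geodesic
afterwards. -/
theorem coarseDist_stem_le {v : P.cayley.V} {l : List P.cayley.E}
    (h : P.cayley.IsPath P.origin l v) (hl : l.length = P.cayley.vdist P.origin v) {N : ℕ}
    {s t : unitInterval} (hst : s ≤ t)
    (ht : P.cayley.coarseDist P.origin (P.cayley.walk P.origin l ((2 * t - 1) * l.length)) ≤ N) :
    P.cayley.coarseDist P.origin (P.cayley.walk P.origin l ((2 * s - 1) * l.length)) ≤
      (N + 5 : ℕ) := by
  have hn := l.length.cast_nonneg (α := ℝ)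
  rcases le_total (2 * s - 1 : ℝ) 0 with hs | hs
  · rw [walk_of_nonpos h (mul_nonpos_of_nonpos_of_nonneg hs hn), coarseDist_vtx, vdist_self]
    positivity
  · have h1 : (s : ℝ) ≤ t := hst
    have h2 := t.2.2
    have := P.edgeConnected_cayley.coarseDist_walk_le_add h (by omega) (mul_nonneg hs hn)
      (mul_le_mul_of_nonneg_right (by linarith) hn)
      (mul_le_of_le_one_left hn (by linarith : (2 * t - 1 : ℝ) ≤ 1))
    push_cast
    linarith

/-- The combing of the van Kampen diagram of a loop `l₁ · e · l₂⁻¹` formed by two geodesics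
and an edge, slid along the loop so that it ends on `e`: over the ends of `e` it runs along the
geodesics in the second half of the time interval. -/
theorem IsExtrinsicTameFilling.exists_edge_combing {f : ℚ → ℚ} (hf : P.IsExtrinsicTameFilling f)
    {l₁ l₂ : List P.cayley.E} {e : P.cayley.E}
    (h₁ : P.cayley.IsPath P.origin l₁ (P.cayley.src e))
    (hl₁ : l₁.length = P.cayley.vdist P.origin (P.cayley.src e))
    (h₂ : P.cayley.IsPath P.origin l₂ (P.cayley.tgt e))
    (hl₂ : l₂.length = P.cayley.vdist P.origin (P.cayley.tgt e)) :
    ∃ H : C(unitInterval × unitInterval, P.cayley.Realization),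
      (∀ t, H (0, t) = P.cayley.walk P.origin l₁ ((2 * t - 1) * l₁.length)) ∧
      (∀ t, H (1, t) = P.cayley.walk P.origin l₂ ((2 * t - 1) * l₂.length)) ∧
      (∀ u, H (u, 0) = P.cayley.vtx P.origin) ∧ (∀ u, H (u, 1) = P.cayley.edge e u) ∧
      ∀ (N : ℕ) (u s t : unitInterval), s ≤ t → P.cayley.coarseDist P.origin (H (u, t)) ≤ N →
        P.cayley.coarseDist P.origin (H (u, s)) ≤ max (f (N + 5 : ℕ)) (N + 5 : ℕ) := by
  let l : List P.cayley.E := l₁ ++ [e] ++ (l₂.map P.cayley.rev).reverse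
  have h₁e := h₁.append (isPath_singleton e)
  have h₂r := h₂.reverse
  have hl : P.cayley.IsPath P.origin l P.origin := h₁e.append h₂r
  have hlen₁e : ((l₁ ++ [e]).length : ℝ) = l₁.length + 1 := by simp
  have hlen : (l.length : ℝ) = l₁.length + 1 + l₂.length := by
    simp [l, add_assoc, add_comm, add_left_comm]
  have hn₁ := l₁.length.cast_nonneg (α := ℝ)
  have hn₂ := l₂.length.cast_nonneg (α := ℝ)
  obtain ⟨χ, hχ, hχ0, hχ1, hχl, hχr, hχt⟩ := hf.exists_loop_combing hl
  let W := P.cayley.walk P.origin l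
  have hW : Continuous W := continuous_walk hl
  let π : unitInterval → unitInterval := fun t => projIcc 0 1 zero_le_one (2 * t)
  have hπ : Continuous π := continuous_projIcc.comp (by fun_prop)
  have hπ1 : ∀ t : unitInterval, (1 / 2 : ℝ) ≤ t → π t = 1 := fun t ht =>
    projIcc_of_right_le _ (by linarith)
  have hπmono : Monotone π := fun s t hst =>
    monotone_projIcc _ (mul_le_mul_of_nonneg_left hst zero_le_two)
  -- Affine in `t`: position `u * l.length` at time `1 / 2`, and the point `u` of the edge `e` at
  -- time 1.
  let pos : unitInterval → unitInterval → ℝ := fun u t =>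
    u * l.length + (2 * t - 1) * (l₁.length + u - u * l.length)
  have hWe : ∀ u : unitInterval, W (l₁.length + u) = P.cayley.edge e u := by
    intro u
    have h0 := u.2.1
    have h1 := u.2.2
    simp only [W, l]
    rw [walk_append_left h₁e h₂r (by linarith),
      walk_append_right h₁ (isPath_singleton e) (by linarith), walk_singleton,
      add_sub_cancel_left, projIcc_val]
  let h : unitInterval × unitInterval → P.cayley.Realization := fun p =>
    if (p.2 : ℝ) ≤ 1 / 2 then χ (p.1 * l.length, π p.2) else W (pos p.1 p.2)
  have hle : ∀ u t : unitInterval, (t : ℝ) ≤ 1 / 2 → h (u, t) = χ (u * l.length, π t) :=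
    fun u t ht => if_pos ht
  -- Time `1 / 2` is included, since the loop combing ends on the loop where the slide begins.
  have hge : ∀ u t : unitInterval, (1 / 2 : ℝ) ≤ t → h (u, t) = W (pos u t) := by
    intro u t ht
    rcases ht.eq_or_lt with ht | ht
    · rw [hle u t ht.ge, hπ1 t ht.le, hχ1]
      simp only [W, pos, ← ht]
      norm_num
    · exact if_neg ht.not_ge
  have hcont : Continuous h := by
    refine Continuous.if_le (hχ.comp ?_) (hW.comp ?_) (by fun_prop) continuous_const ?_
    · exact Continuous.prodMk (by fun_prop) (hπ.comp continuous_snd)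
    · simp only [pos]
      fun_prop
    · rintro ⟨u, t⟩ ht
      exact (hle u t ht.le).symm.trans (hge u t ht.ge)
  refine ⟨⟨h, hcont⟩, fun t => ?_, fun t => ?_, fun u => ?_, fun u => ?_, ?_⟩
  · change h (0, t) = _
    rcases le_total (t : ℝ) (1 / 2) with ht | ht
    · rw [hle 0 t ht, hχl _ _ (by simp), walk_of_nonpos h₁]
      exact mul_nonpos_of_nonpos_of_nonneg (by linarith) hn₁
    · rw [hge 0 t ht]
      have h1 := t.2.2
      have h2 : (2 * t - 1 : ℝ) * l₁.length ≤ 1 * l₁.length :=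
        mul_le_mul_of_nonneg_right (by linarith) hn₁
      simp only [W, l, pos, Icc.coe_zero, zero_mul, zero_add, add_zero, sub_zero]
      rw [walk_append_left h₁e h₂r (by linarith),
        walk_append_left h₁ (isPath_singleton e) (by linarith)]
  · change h (1, t) = _
    rcases le_total (t : ℝ) (1 / 2) with ht | ht
    · rw [hle 1 t ht, hχr _ _ (by simp), walk_of_nonpos h₂]
      exact mul_nonpos_of_nonpos_of_nonneg (by linarith) hn₂
    · rw [hge 1 t ht]
      have h1 := t.2.2
      have h2 : (2 * t - 1 : ℝ) * l₂.length ≤ 1 * l₂.length :=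
        mul_le_mul_of_nonneg_right (by linarith) hn₂
      -- For `u = 1` the slide starts at the end of the loop and runs backwards, hence forwards
      -- along `l₂`.
      have h3 : pos 1 t = l₁.length + 1 + l₂.length - (2 * t - 1) * l₂.length := by
        simp only [pos, hlen, Icc.coe_one]
        ring
      rw [h3]
      simp only [W, l]
      rw [walk_append_right h₁e h₂r (by linarith), walk_reverse h₂, hlen₁e]
      congr 1
      ring
  · change h (u, 0) = _
    have : π 0 = 0 := by
      simp only [π, Icc.coe_zero, mul_zero]
      exact projIcc_left _
    rw [hle u 0 (by norm_num), this, hχ0]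
  · change h (u, 1) = _
    rw [hge u 1 (by norm_num), ← hWe]
    congr 1
    simp only [pos, Icc.coe_one]
    ring
  · intro N u s t hst hN
    change P.cayley.coarseDist P.origin (h (u, t)) ≤ N at hN
    change P.cayley.coarseDist P.origin (h (u, s)) ≤ _
    have hst' : (s : ℝ) ≤ t := hst
    have hu0 := u.2.1
    have hu1 := u.2.2
    have hslide : ∀ a b : unitInterval, (1 / 2 : ℝ) ≤ a → (a : ℝ) ≤ b →
        P.cayley.coarseDist P.origin (h (u, a)) ≤ P.cayley.coarseDist P.origin (h (u, b)) + 5 := by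
      intro a b ha hab
      have hb := b.2.2
      rw [hge u a ha, hge u b (ha.trans hab)]
      refine coarseDist_walk_slide_le h₁ hl₁ h₂ hl₂ ?_ ?_ ?_ ?_ ?_ ?_ ?_
      · positivity
      · rw [← hlen]
        exact mul_le_of_le_one_left (Nat.cast_nonneg _) hu1
      all_goals linarith
    have htame : ∀ a b : unitInterval, a ≤ b → (b : ℝ) ≤ 1 / 2 →
        P.cayley.coarseDist P.origin (h (u, b)) ≤ (N + 5 : ℕ) →
        P.cayley.coarseDist P.origin (h (u, a)) ≤ max (f (N + 5 : ℕ)) (N + 5 : ℕ) := by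
      intro a b hab hb hbN
      have hab' : (a : ℝ) ≤ b := hab
      rw [hle u b hb] at hbN
      rw [hle u a (hab'.trans hb)]
      -- `IsTame` compares distinct times only; equal times account for the `N + 5` in the maximum.
      rcases (hπmono hab).eq_or_lt with heq | hlt
      · rw [heq]
        exact hbN.trans (le_max_right _ _)
      · exact (hχt _ _ _ hlt).trans ((hf.2.1 (coarseDist_mem_quarterNat _ _)
          (natCast_mem_quarterNat _) hbN).trans (le_max_left _ _))
    have hN5 : (N : ℚ) + 5 = (N + 5 : ℕ) := by push_cast; rfl
    rcases le_total (t : ℝ) (1 / 2) with ht | ht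
    · exact htame s t hst ht (by linarith)
    · rcases le_total (s : ℝ) (1 / 2) with hs | hs
      -- Going back across time `1 / 2`: the slide costs 5, and tameness applies from there on.
      · let m : unitInterval := ⟨1 / 2, by norm_num, by norm_num⟩
        refine htame s m hs le_rfl ?_
        have := hslide m t le_rfl ht
        linarith
      · have := hslide s t hs hst
        exact (show _ ≤ ((N + 5 : ℕ) : ℚ) by linarith).trans (le_max_right _ _)

/-! ### The tame 1-combing of the Cayley complex. -/

theorem IsExtrinsicTameFilling.tameCombable {f : ℚ → ℚ} (hf : P.IsExtrinsicTameFilling f) :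
    TameCombable G := by
  choose γ hγ hγlen using fun v =>
    exists_isPath_length_eq_vdist (P.edgeConnected_cayley P.origin v)
  choose H hH0 hH1 hHz hHo hHt using fun e => hf.exists_edge_combing (hγ (P.cayley.src e))
    (hγlen _) (hγ (P.cayley.tgt e)) (hγlen _)
  let V : P.cayley.V → C(unitInterval, P.cayley.Realization) := fun v =>
    ⟨fun t => P.cayley.walk P.origin (γ v) ((2 * t - 1) * (γ v).length),
      (continuous_walk (hγ v)).comp (by fun_prop)⟩
  let _ : Inhabited C(unitInterval, P.cayley.Realization) := ⟨V P.origin⟩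
  -- Each edge combing is regarded as a path in the space of maps from the interval to `X`, joining
  -- the geodesic stems of its ends; gluing then takes place over the 1-skeleton alone.
  obtain ⟨φ, hφV, hφE⟩ := P.cayley.exists_continuous_skel1 V (fun e => (H e).curry)
    (fun e => ContinuousMap.ext (hH0 e)) (fun e => ContinuousMap.ext (hH1 e))
  have hcases : ∀ p : P.cayley.skel1, (∃ v, p.1 = P.cayley.vtx v ∧ ∀ t, φ p t = V v t) ∨
      ∃ e u, p.1 = P.cayley.edge e u ∧ ∀ t, φ p t = H e (u, t) := by
    rintro ⟨x, hx⟩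
    rcases id hx with ⟨v, rfl⟩ | hx'
    · exact Or.inl ⟨v, rfl, fun t => congrArg (· t) (hφV v)⟩
    · obtain ⟨e, t, rfl⟩ := mem_iUnion.1 hx'
      obtain ⟨e', t', h1, h2⟩ := hφE e t
      exact Or.inr ⟨e', t', h1, fun s => congrArg (· s) h2⟩
  have hV0 : ∀ v, V v 0 = P.cayley.vtx P.origin := fun v =>
    walk_of_nonpos (hγ v) (mul_nonpos_of_nonpos_of_nonneg (by norm_num) (Nat.cast_nonneg _))
  have hzero : ∀ p, φ p 0 = P.cayley.vtx P.origin := by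
    intro p
    rcases hcases p with ⟨v, -, hv⟩ | ⟨e, u, -, hu⟩
    · rw [hv, hV0]
    · rw [hu, hHz]
  -- Uncurrying preserves continuity because the interval is locally compact.
  have hcont : Continuous fun p : P.cayley.skel1 × unitInterval => φ p.1 p.2 :=
    ContinuousMap.continuous_uncurry_of_continuous φ
  refine ⟨P, fun p => φ p.1 p.2, ⟨hcont, hzero, fun p => ?_, fun h t => ?_, ?_⟩, fun C hC => ?_⟩
  · rcases hcases p with ⟨v, hp, hv⟩ | ⟨e, u, hp, hu⟩
    · rw [hv, hp]
      exact walk_of_length_le (hγ v) (by simp; linarith)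
    · rw [hu, hHo, hp]
  · have hnil : γ P.origin = [] := List.length_eq_zero_iff.1 ((hγlen _).trans (vdist_self _))
    refine (congrArg (· t) (hφV P.origin)).trans ?_
    change P.cayley.walk P.origin (γ P.origin) _ = _
    rw [hnil]
    rfl
  · rintro ⟨x, hx⟩ ⟨v, rfl⟩ t
    have : φ ⟨P.cayley.vtx v, hx⟩ t = V v t := congrArg (· t) (hφV v)
    exact this ▸ walk_mem_skel1 (hγ v) _
  · obtain ⟨N, hN⟩ := P.exists_coarseDist_le_of_isCompact hC
    -- The maximum with 0 puts the basepoint into `D`.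
    let M : ℚ := max (max (f (N + 5 : ℕ)) (N + 5 : ℕ)) 0
    have hbound : ∀ p s t, s ≤ t → P.cayley.coarseDist P.origin (φ p t) ≤ N →
        P.cayley.coarseDist P.origin (φ p s) ≤ M := by
      intro p s t hst ht
      rcases hcases p with ⟨v, -, hv⟩ | ⟨e, u, -, hu⟩
      · rw [hv] at ht ⊢
        exact (coarseDist_stem_le (hγ v) (hγlen v) hst ht).trans
          ((le_max_right _ _).trans (le_max_left _ _))
      · rw [hu] at ht ⊢
        exact (hHt e N u s t hst ht).trans (le_max_left _ _)
    have : PathConnectedSpace unitInterval := isPathConnected_iff_pathConnectedSpace.1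
      ((convex_Icc 0 1).isPathConnected ⟨0, unitInterval.zero_mem⟩)
    obtain ⟨D, hD, hDM⟩ := P.exists_isCompact_sublevel M
    refine ⟨D, hD, fun τ hτ => ?_⟩
    -- The vertical segment below `x` stays in the preimage of `D` by `hbound`.
    have hdown : ∀ x ∈ (fun p : P.cayley.skel1 × unitInterval => φ p.1 p.2) ⁻¹' C ∩
        {z | z.1.1 ∈ τ}, JoinedIn ((fun p : P.cayley.skel1 × unitInterval => φ p.1 p.2) ⁻¹' D ∩
          {z | z.1.1 ∈ τ}) (x.1, 0) x := by
      rintro ⟨p, t⟩ ⟨hxC, hxτ⟩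
      refine ⟨⟨⟨fun s => (p, s * t), by fun_prop⟩, by simp, by simp⟩, fun s => ⟨?_, hxτ⟩⟩
      exact hDM _ (hbound p _ t unitInterval.mul_le_right (hN _ hxC))
    have hD0 : P.cayley.vtx P.origin ∈ D := hDM _ (by
      rw [coarseDist_vtx, vdist_self, Nat.cast_zero]
      exact le_max_right _ _)
    intro x hx y hy
    refine ((hdown x hx).symm.trans ?_).trans (hdown y hy)
    obtain ⟨⟨p, hp⟩, t⟩ := x
    obtain ⟨⟨p', hp'⟩, t'⟩ := y
    rcases hτ with ⟨v, rfl⟩ | ⟨e, rfl⟩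
    · obtain rfl : p = P.cayley.vtx v := hx.2
      obtain rfl : p' = P.cayley.vtx v := hy.2
      exact (hdown _ hx).source_mem |> JoinedIn.refl
    · obtain ⟨a, rfl⟩ : ∃ a, P.cayley.edge e a = p := hx.2
      obtain ⟨b, rfl⟩ : ∃ b, P.cayley.edge e b = p' := hy.2
      have hf : Continuous fun c : unitInterval =>
          ((⟨P.cayley.edge e c, P.cayley.edge_mem_skel1 e c⟩, 0) :
            P.cayley.skel1 × unitInterval) :=
        ((P.cayley.continuous_edge e).subtype_mk _).prodMk continuous_const
      -- At time 0 the whole edge is sent to the basepoint, so the bottom side joins the two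
      -- vertical segments.
      refine ((isPathConnected_range hf).joinedIn _ ⟨a, rfl⟩ _ ⟨b, rfl⟩).mono ?_
      rintro _ ⟨c, rfl⟩
      refine ⟨?_, mem_range_self c⟩
      change φ _ 0 ∈ D
      rwa [hzero]

end SymPresentation

theorem mainTheorem2 {G : Type u} [Group G]
    (h : ∃ (P : SymPresentation G) (f : ℚ → ℚ), P.IsExtrinsicTameFilling f) :
    TameCombable G := by
  obtain ⟨P, f, hf⟩ := h
  exact hf.tameCombable
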